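/- Let $S^2\subset\mathbb R^3$ be the unit sphere with its geodesic distance and its surface measure (total mass $4\pi$), and for $N\ge 1$ let $\mathcal H_N$ be the real vector space of spherical harmonics of degree $N$, i.e. of the restrictions to $S^2$ of real homogeneous harmonic polynomials of degree $N$ on $\mathbb R^3$; let $d_N=\dim\mathcal H_N$. Let $\phi_1,\dots,\phi_{d_N}$ be an orthonormal basis of $\mathcal H_N$ for the inner product of $L^2(S^2)$. A random spherical harmonic of degree $N$ is $f=\sum_{j=1}^{d_N}c_j\phi_j$, where either (i) (Gaussian ensemble) $c_1,\dots,c_{d_N}$ are independent centred real Gaussian variables of variance $1/d_N$ (so that $\mathbb E\|f\|_{L^2}^2=1$), or (ii) (spherical ensemble) $c=(c_1,\dots,c_{d_N})$ is uniformly distributed on the unit sphere of $\mathbb R^{d_N}$ (so that $\|f\|_{L^2}=1$). **Estimate of the maximum.** For every $\rho>0$ there exists a constant $A$, depending only on $\rho$, such that for every $N\ge1$, every orthonormal basis $\phi_1,\dots,\phi_{d_N}$ of $\mathcal H_N$ and every $x_0\in S^2$, in both ensembles, $$\mathbb P\Big\{\max_{\mathcal B(x_0,\rho/N)}|f|\ge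 A\Big\}\le\tfrac13 ,$$ where $\mathcal B(x_0,r)$ is the closed geodesic ball of centre $x_0$ and radius $r$. -/

import Mathlib

open MeasureTheory ProbabilityTheory

noncomputable section

namespace RandomSphericalHarmonics

/-- Euclidean three-space. -/
abbrev E3 : Type := EuclideanSpace ℝ (Fin 3)

/-- The round unit sphere `S²`. -/
abbrev S2 : Type := Metric.sphere (0 : E3) 1

/-- The (unnormalized, total mass `4π`) surface measure of `S²`. -/
def surfaceMeasure : Measure S2 := (volume : Measure E3).toSphere

/-- The Laplacian `∑ ∂²/∂xᵢ²` on real polynomials in three variables. -/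
def polyLaplacian : MvPolynomial (Fin 3) ℝ →ₗ[ℝ] MvPolynomial (Fin 3) ℝ :=
  ∑ i : Fin 3, (MvPolynomial.pderiv i).toLinearMap ∘ₗ (MvPolynomial.pderiv i).toLinearMap

/-- Restriction of a polynomial to `S²`, as a continuous function. -/
def restrictToSphere : MvPolynomial (Fin 3) ℝ →ₗ[ℝ] C(S2, ℝ) where
  toFun p := ⟨fun x => MvPolynomial.eval (fun i => (x : E3) i) p, by
    have h : Continuous fun x : S2 => fun i : Fin 3 => (x : E3) i := by fun_prop
    exact (MvPolynomial.continuous_eval p).comp h⟩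
  map_add' p q := by ext x; simp
  map_smul' a p := by ext x; simp

/-- The real vector space `H_N` of spherical harmonics of degree `N` on `S²`: restrictions to the
sphere of the homogeneous harmonic polynomials of degree `N` on `ℝ³`. -/
def sphHarm (N : ℕ) : Submodule ℝ C(S2, ℝ) :=
  (MvPolynomial.homogeneousSubmodule (Fin 3) ℝ N ⊓ LinearMap.ker polyLaplacian).map
    restrictToSphere

/-- `d_N = dim H_N`. -/
def sphDim (N : ℕ) : ℕ := Module.finrank ℝ (sphHarm N)

/-- `φ` is a basis of `H_N` which is orthonormal for the inner product of `L²(S²)`. -/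
structure IsOrthonormalBasis (N : ℕ) (φ : Fin (sphDim N) → C(S2, ℝ)) : Prop where
  orthonormal : ∀ j k, ∫ x, φ j x * φ k x ∂surfaceMeasure = if j = k then 1 else 0
  span_eq : Submodule.span ℝ (Set.range φ) = sphHarm N

/-- The function `∑ⱼ cⱼ φⱼ` on the sphere. -/
def combination {d : ℕ} (φ : Fin d → C(S2, ℝ)) (c : Fin d → ℝ) : C(S2, ℝ) :=
  ∑ j, c j • φ j

/-- The law of a vector of `d` independent centred Gaussian coefficients of variance `1 / d`. -/
def gaussianCoeffLaw (d : ℕ) : Measure (Fin d → ℝ) :=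
  Measure.pi fun _ => gaussianReal 0 (1 / (d : NNReal))

/-- The uniform (normalized surface) measure on the unit sphere of `ℝᵈ`. -/
def uniformSphereLaw (d : ℕ) : Measure (Metric.sphere (0 : EuclideanSpace ℝ (Fin d)) 1) :=
  ((volume : Measure (EuclideanSpace ℝ (Fin d))).toSphere Set.univ)⁻¹ •
    (volume : Measure (EuclideanSpace ℝ (Fin d))).toSphere

/-- The closed geodesic ball of `S²` with centre `x₀` and radius `r`: the geodesic distance between
two points of the unit sphere is the angle between them. -/
def geodesicBall (x₀ : S2) (r : ℝ) : Set S2 :=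
  {x | InnerProductGeometry.angle (x₀ : E3) (x : E3) ≤ r}

/-- The maximum of `|f|` over the closed geodesic ball of centre `x₀` and radius `r`
(it is attained when `0 ≤ r`, see `isGreatest_maxOnBall`). -/
def maxOnBall (f : C(S2, ℝ)) (x₀ : S2) (r : ℝ) : ℝ :=
  sSup ((fun x => |f x|) '' geodesicBall x₀ r)

theorem isGreatest_maxOnBall (f : C(S2, ℝ)) (x₀ : S2) {r : ℝ} (hr : 0 ≤ r) :
    IsGreatest ((fun x => |f x|) '' geodesicBall x₀ r) (maxOnBall f x₀ r) := by
  have ne : ∀ x : S2, (x : E3) ≠ 0 := fun x => ne_zero_of_mem_unit_sphere x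
  have hc : Continuous fun x : S2 => InnerProductGeometry.angle (x₀ : E3) (x : E3) := by
    rw [continuous_iff_continuousAt]
    intro x
    have h1 : ContinuousAt (fun y : S2 => ((x₀ : E3), (y : E3))) x := by fun_prop
    exact ContinuousAt.comp (f := fun y : S2 => ((x₀ : E3), (y : E3)))
      (InnerProductGeometry.continuousAt_angle (x := ((x₀ : E3), (x : E3))) (ne x₀) (ne x)) h1
  have hK : IsCompact (geodesicBall x₀ r) :=
    (isClosed_le hc continuous_const).isCompact
  have hne : (geodesicBall x₀ r).Nonempty :=
    ⟨x₀, by simpa [geodesicBall, InnerProductGeometry.angle_self (ne x₀)] using hr⟩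
  exact (hK.image (by fun_prop)).isGreatest_sSup (hne.image _)

/-- Orthonormal bases of `H_N` exist. -/
theorem exists_isOrthonormalBasis (N : ℕ) : ∃ φ, IsOrthonormalBasis N φ := by
  have : IsFiniteMeasure surfaceMeasure := by unfold surfaceMeasure; infer_instance
  have : surfaceMeasure.IsOpenPosMeasure := by unfold surfaceMeasure; infer_instance
  let T : C(S2, ℝ) →ₗ[ℝ] Lp ℝ 2 surfaceMeasure :=
    (ContinuousMap.toLp 2 surfaceMeasure ℝ : C(S2, ℝ) →L[ℝ] Lp ℝ 2 surfaceMeasure).toLinearMap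
  have hT : Function.Injective T := ContinuousMap.toLp_injective surfaceMeasure
  have : FiniteDimensional ℝ (MvPolynomial.homogeneousSubmodule (Fin 3) ℝ N) :=
    Module.Finite.iff_fg.mpr (MvPolynomial.homogeneousSubmodule_fg _ _ N)
  have : FiniteDimensional ℝ (sphHarm N) := by
    have := Submodule.finiteDimensional_inf_left
      (MvPolynomial.homogeneousSubmodule (Fin 3) ℝ N) (LinearMap.ker polyLaplacian)
    unfold sphHarm
    infer_instance
  let e := Submodule.equivMapOfInjective T hT (sphHarm N)
  have hdim : Module.finrank ℝ ((sphHarm N).map T) = sphDim N := e.finrank_eq.symm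
  let b := (stdOrthonormalBasis ℝ ((sphHarm N).map T)).reindex (finCongr hdim)
  have hTe : ∀ j, T (e.symm (b j)).1 = (b j : Lp ℝ 2 surfaceMeasure) := fun j => by
    have := Submodule.coe_equivMapOfInjective_apply T hT (sphHarm N) (e.symm (b j))
    rw [← this]
    exact congrArg Subtype.val (e.apply_symm_apply (b j))
  refine ⟨fun j => (e.symm (b j)).1, fun j k => ?_, ?_⟩
  · have h := (orthonormal_iff_ite.mp b.orthonormal) k j
    rw [Submodule.coe_inner, ← hTe j, ← hTe k] at h
    have h2 := ContinuousMap.inner_toLp (𝕜 := ℝ) surfaceMeasure (e.symm (b k)).1 (e.symm (b j)).1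
    have h3 := h2.symm.trans h
    simp only [eq_comm (a := k) (b := j)] at h3
    rw [← h3]
    simp
  · have h1 : Set.range (fun j => (e.symm (b j)).1) =
        (sphHarm N).subtype '' (e.symm '' Set.range b) := by
      rw [← Set.range_comp, ← Set.range_comp]; rfl
    have h2 : Submodule.span ℝ (Set.range b) = ⊤ := by
      simpa using b.toBasis.span_eq
    have h3 : Submodule.span ℝ (e.symm '' Set.range b) = ⊤ := by
      have := Submodule.span_image (e.symm.toLinearMap) (s := Set.range b)
      rw [h2] at this
      refine this.trans ?_
      simp
    rw [h1, Submodule.span_image, h3]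
    simp

end RandomSphericalHarmonics

end

open RandomSphericalHarmonics

/-!
Write the random harmonic as the restriction to the sphere of `F = ∑ cⱼ Pⱼ`, where the `Pⱼ` are the
homogeneous harmonic polynomials of degree `N` extending the `φⱼ`. The only property of the two
ensembles which is used is `E[cⱼ cₖ] = δⱼₖ / d_N` (`IsIsotropic`).

* A harmonic polynomial satisfies the mean value property for Gaussian averages, at every scale
  (`gaussAverage_of_harmonic`): by the heat equation, the derivative of the average in the scale is
  an average of the Laplacian. Jensen's inequality, and a comparison of Gaussian weights with
  different centres, then bound the square of the maximum over a ball of radius `ρ / N` by a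
  constant times a Gaussian average of `F²` at scale `1 / N` around the centre of the ball
  (`sq_eval_le_of_harmonic`, `sq_maxOnBall_le`). That average is a quadratic form in `c`, the
  `localEnergy`.
* The expectation of the local energy is the Gaussian average of `∑ Pⱼ² / d_N`. On the sphere
  `∑ φⱼ²` is invariant under rotations, hence constant, hence equal to `d_N` divided by the area
  (`sum_sq_comp_sphereMap`, `sum_sq_eq_div`). By homogeneity `∑ Pⱼ(y)² / d_N` is `|y|^(2N)` divided
  by the area, and at `y = x₀ + z / N` this is at most `exp (2 ∑ |zᵢ|)` up to that factor, which is
  integrable against the Gaussian weight, uniformly in `N` (`integral_localEnergy_le`).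

Markov's inequality concludes.
-/

noncomputable section

namespace RandomSphericalHarmonics

/-! ### Gaussian averages of polynomials -/

/-- A power times a centred Gaussian density is integrable. -/
theorem integrable_pow_mul_exp {b : ℝ} (hb : 0 < b) (k : ℕ) :
    Integrable fun z : ℝ => z ^ k * Real.exp (-b * z ^ 2) := by
  have h := integrable_rpow_mul_exp_neg_mul_sq hb (s := (k : ℝ))
    (by have : (0 : ℝ) ≤ k := k.cast_nonneg
        linarith)
  simpa only [Real.rpow_natCast] using h

theorem integrable_eval_mul_exp {b : ℝ} (hb : 0 < b) (q : Polynomial ℝ) :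
    Integrable fun z : ℝ => q.eval z * Real.exp (-b * z ^ 2) := by
  simp only [Polynomial.eval_eq_sum, Polynomial.sum, Finset.sum_mul, mul_assoc]
  exact integrable_finsetSum _ fun k _ => (integrable_pow_mul_exp hb k).const_mul _

theorem integrable_affine_pow_mul_exp {b : ℝ} (hb : 0 < b) (x t : ℝ) (a : ℕ) :
    Integrable fun z : ℝ => (x + t * z) ^ a * Real.exp (-b * z ^ 2) := by
  have h := integrable_eval_mul_exp hb ((Polynomial.C x + Polynomial.C t * Polynomial.X) ^ a)
  simpa only [Polynomial.eval_pow, Polynomial.eval_add, Polynomial.eval_mul, Polynomial.eval_C,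
    Polynomial.eval_X] using h

/-- The Gaussian average of `(x + t z) ^ a` in the variable `z`, with the unnormalized weight
`exp (-z² / 2)`. -/
def gaussMoment (x t : ℝ) (a : ℕ) : ℝ :=
  ∫ z : ℝ, (x + t * z) ^ a * Real.exp (-(1 / 2) * z ^ 2)

/-- Gaussian integration by parts (Stein's identity) for powers. The factor `a` vanishes when the
exponent `a - 1` is truncated. -/
theorem gaussMoment_succ (x t : ℝ) (a : ℕ) :
    gaussMoment x t (a + 1) = x * gaussMoment x t a + t ^ 2 * a * gaussMoment x t (a - 1) := by
  have hb : (0 : ℝ) < 1 / 2 := by norm_num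
  have hE : ∀ z : ℝ, HasDerivAt (fun z : ℝ => Real.exp (-(1 / 2) * z ^ 2))
      (-(z * Real.exp (-(1 / 2) * z ^ 2))) z := fun z => by
    have h := ((hasDerivAt_pow 2 z).const_mul (-(1 / 2) : ℝ)).exp
    convert h using 1
    push_cast
    ring
  have hP : ∀ z : ℝ, HasDerivAt (fun z : ℝ => (x + t * z) ^ a)
      (a * (x + t * z) ^ (a - 1) * t) z := fun z => by
    have h := (((hasDerivAt_id z).const_mul t).const_add x).fun_pow a
    simpa using h
  have hint : Integrable fun z : ℝ => (x + t * z) ^ a * (z * Real.exp (-(1 / 2) * z ^ 2)) := by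
    have h := integrable_eval_mul_exp hb
      ((Polynomial.C x + Polynomial.C t * Polynomial.X) ^ a * Polynomial.X)
    simpa [mul_assoc] using h
  have key := integral_mul_deriv_eq_deriv_mul_of_integrable
    (u := fun z : ℝ => (x + t * z) ^ a) (v := fun z : ℝ => Real.exp (-(1 / 2) * z ^ 2))
    (fun z _ => hP z) (fun z _ => hE z)
    (by simpa [Pi.mul_def] using hint.neg)
    (by
      have h := (integrable_affine_pow_mul_exp hb x t (a - 1)).const_mul (a * t : ℝ)
      refine h.congr (Filter.Eventually.of_forall fun z => ?_)
      simp only [Pi.mul_apply]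
      ring)
    (integrable_affine_pow_mul_exp hb x t a)
  have h1 : ∫ z : ℝ, (x + t * z) ^ a * (z * Real.exp (-(1 / 2) * z ^ 2)) =
      a * t * gaussMoment x t (a - 1) := by
    have h2 : ∫ z : ℝ, (a * (x + t * z) ^ (a - 1) * t) * Real.exp (-(1 / 2) * z ^ 2) =
        a * t * gaussMoment x t (a - 1) := by
      rw [gaussMoment, ← integral_const_mul]
      congr 1 with z
      ring
    rw [← h2]
    simp only [mul_neg, integral_neg, neg_inj] at key
    exact key
  have h3 : gaussMoment x t (a + 1) = ∫ z : ℝ,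
      (x * ((x + t * z) ^ a * Real.exp (-(1 / 2) * z ^ 2)) +
        t * ((x + t * z) ^ a * (z * Real.exp (-(1 / 2) * z ^ 2)))) := by
    rw [gaussMoment]
    congr 1 with z
    ring
  rw [h3, integral_add ((integrable_affine_pow_mul_exp hb x t a).const_mul x) (hint.const_mul t),
    integral_const_mul, integral_const_mul, h1, ← gaussMoment]
  ring

/-- The heat equation for Gaussian averages of powers: the derivative in `t` is `t` times the
average of the second derivative of the power. -/
theorem hasDerivAt_gaussMoment (x t : ℝ) (a : ℕ) :
    HasDerivAt (fun t => gaussMoment x t a)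
      (t * (a * (a - 1 : ℕ) * gaussMoment x t (a - 2))) t := by
  have h : ∀ a, HasDerivAt (fun t => gaussMoment x t a)
        (t * (a * (a - 1 : ℕ) * gaussMoment x t (a - 2))) t ∧
      HasDerivAt (fun t => gaussMoment x t (a + 1))
        (t * ((a + 1 : ℕ) * a * gaussMoment x t (a - 1))) t := by
    intro a
    induction a with
    | zero =>
      have h0 : (fun t => gaussMoment x t 0) = fun _ => gaussMoment x 0 0 := by
        ext t; simp [gaussMoment]
      have h1 : (fun t => gaussMoment x t 1) = fun _ => x * gaussMoment x 0 0 := by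
        ext t
        rw [gaussMoment_succ, ← congrFun h0 t]
        simp
      simp only [zero_add, h0, h1]
      simp [hasDerivAt_const]
    | succ n ih =>
      refine ⟨by simpa using ih.2, ?_⟩
      have hr : (fun t => gaussMoment x t (n + 1 + 1)) = fun t =>
          x * gaussMoment x t (n + 1) + t ^ 2 * (n + 1 : ℕ) * gaussMoment x t n := by
        ext t
        rw [gaussMoment_succ]
        simp
      rw [hr]
      have hd := (ih.2.const_mul x).fun_add
        ((((hasDerivAt_pow 2 t).mul_const ((n + 1 : ℕ) : ℝ))).fun_mul ih.1)
      refine hd.congr_deriv ?_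
      rcases n with _ | n
      · simp
        ring
      · simp only [Nat.add_sub_cancel]
        rw [gaussMoment_succ x t n, show n + 1 - 2 = n - 1 by omega]
        push_cast
        ring
  exact (h a).1

/-- The unnormalized Gaussian weight `exp (-b |z|²)` on `ℝ³`, as a product over coordinates. -/
def gaussWeight (b : ℝ) (z : Fin 3 → ℝ) : ℝ := ∏ i, Real.exp (-b * z i ^ 2)

theorem gaussWeight_pos (b : ℝ) (z : Fin 3 → ℝ) : 0 < gaussWeight b z :=
  Finset.prod_pos fun _ _ => Real.exp_pos _

theorem monomial_mul_gaussWeight (b : ℝ) (x : Fin 3 → ℝ) (t : ℝ) (s : Fin 3 →₀ ℕ) (r : ℝ)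
    (z : Fin 3 → ℝ) :
    MvPolynomial.eval (x + t • z) (MvPolynomial.monomial s r) * gaussWeight b z =
      r * ∏ i, ((x i + t * z i) ^ s i * Real.exp (-b * z i ^ 2)) := by
  rw [MvPolynomial.eval_monomial, Finsupp.prod_fintype _ _ (by simp), Finset.prod_mul_distrib,
    gaussWeight, mul_assoc]
  simp

theorem integrable_eval_mul_gaussWeight {b : ℝ} (hb : 0 < b) (x : Fin 3 → ℝ) (t : ℝ)
    (p : MvPolynomial (Fin 3) ℝ) :
    Integrable fun z : Fin 3 → ℝ => MvPolynomial.eval (x + t • z) p * gaussWeight b z := by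
  induction p using MvPolynomial.induction_on' with
  | monomial s r =>
    simp only [monomial_mul_gaussWeight]
    exact (Integrable.fintype_prod (μ := fun _ : Fin 3 => (volume : Measure ℝ))
      (f := fun i z => (x i + t * z) ^ s i * Real.exp (-b * z ^ 2))
      fun i => integrable_affine_pow_mul_exp hb (x i) t (s i)).const_mul r
  | add p q hp hq => simp only [map_add, add_mul]; exact hp.add hq

/-- The Gaussian average of a polynomial around `x` at scale `t` (not normalized). -/
def gaussAverage (x : Fin 3 → ℝ) (t : ℝ) (p : MvPolynomial (Fin 3) ℝ) : ℝ :=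
  ∫ z : Fin 3 → ℝ, MvPolynomial.eval (x + t • z) p * gaussWeight (1 / 2) z

theorem gaussAverage_add (x : Fin 3 → ℝ) (t : ℝ) (p q : MvPolynomial (Fin 3) ℝ) :
    gaussAverage x t (p + q) = gaussAverage x t p + gaussAverage x t q := by
  have hb : (0 : ℝ) < 1 / 2 := by norm_num
  simp only [gaussAverage, map_add, add_mul]
  exact integral_add (integrable_eval_mul_gaussWeight hb x t p)
    (integrable_eval_mul_gaussWeight hb x t q)

theorem gaussAverage_monomial (x : Fin 3 → ℝ) (t : ℝ) (s : Fin 3 →₀ ℕ) (r : ℝ) :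
    gaussAverage x t (MvPolynomial.monomial s r) = r * ∏ i, gaussMoment (x i) t (s i) := by
  simp only [gaussAverage, monomial_mul_gaussWeight, integral_const_mul, gaussMoment]
  rw [integral_fintype_prod_volume_eq_prod
    (fun i z => (x i + t * z) ^ s i * Real.exp (-(1 / 2) * z ^ 2))]

theorem polyLaplacian_apply (p : MvPolynomial (Fin 3) ℝ) :
    polyLaplacian p = ∑ i, MvPolynomial.pderiv i (MvPolynomial.pderiv i p) := by
  simp [polyLaplacian]

/-- The heat equation: the derivative in the scale of a Gaussian average is `t` times the Gaussian
average of the Laplacian. -/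
theorem hasDerivAt_gaussAverage (x : Fin 3 → ℝ) (t : ℝ) (p : MvPolynomial (Fin 3) ℝ) :
    HasDerivAt (fun t => gaussAverage x t p) (t * gaussAverage x t (polyLaplacian p)) t := by
  induction p using MvPolynomial.induction_on' with
  | monomial s r =>
    simp only [polyLaplacian_apply, MvPolynomial.pderiv_monomial, Fin.sum_univ_three,
      gaussAverage_add, gaussAverage_monomial, Fin.prod_univ_three]
    have h := (((hasDerivAt_gaussMoment (x 0) t (s 0)).fun_mul
      (hasDerivAt_gaussMoment (x 1) t (s 1))).fun_mul
      (hasDerivAt_gaussMoment (x 2) t (s 2))).const_mul r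
    refine h.congr_deriv ?_
    simp [Nat.sub_sub]
    ring
  | add p q hp hq =>
    simp only [map_add, gaussAverage_add, mul_add]
    exact hp.add hq

/-- The mean value property of harmonic polynomials, for Gaussian averages. -/
theorem gaussAverage_of_harmonic (x : Fin 3 → ℝ) (t : ℝ) {p : MvPolynomial (Fin 3) ℝ}
    (hp : polyLaplacian p = 0) :
    gaussAverage x t p = MvPolynomial.eval x p * ∫ z, gaussWeight (1 / 2) z := by
  have hd : ∀ t, HasDerivAt (fun t => gaussAverage x t p) 0 t := fun t => by
    simpa [hp, gaussAverage] using hasDerivAt_gaussAverage x t p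
  have h := is_const_of_deriv_eq_zero (fun t => (hd t).differentiableAt) (fun t => (hd t).deriv) t 0
  rw [h]
  simp [gaussAverage, integral_const_mul]

/-- Local boundedness of harmonic polynomials: at a point at distance at most `ρ t` from `x`, the
square is controlled by a Gaussian average of the square around `x`, at scale `t`. -/
theorem sq_eval_le_of_harmonic {ρ : ℝ} (x h : Fin 3 → ℝ) (t : ℝ) {p : MvPolynomial (Fin 3) ℝ}
    (hp : polyLaplacian p = 0) (hh : ∑ i, h i ^ 2 ≤ ρ ^ 2) :
    MvPolynomial.eval (x + t • h) p ^ 2 * ∫ z, gaussWeight (1 / 2) z ≤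
      Real.exp (ρ ^ 2 / 2) *
        ∫ z, MvPolynomial.eval (x + t • z) p ^ 2 * gaussWeight (1 / 4) z := by
  have hb : (0 : ℝ) < 1 / 2 := by norm_num
  set a := MvPolynomial.eval (x + t • h) p with ha
  set y := x + t • h with hy
  have hW : Integrable (gaussWeight (1 / 2)) := by
    simpa using integrable_eval_mul_gaussWeight hb y t 1
  have h1 := integrable_eval_mul_gaussWeight hb y t p
  have h2 := integrable_eval_mul_gaussWeight hb y t (p ^ 2)
  have h4 := integrable_eval_mul_gaussWeight (b := 1 / 4) (by norm_num) x t (p ^ 2)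
  simp only [map_pow] at h2 h4
  have hmean : ∫ z, MvPolynomial.eval (y + t • z) p * gaussWeight (1 / 2) z =
      a * ∫ z, gaussWeight (1 / 2) z := gaussAverage_of_harmonic y t hp
  -- Jensen's inequality: the variance of `p` under the weight centred at `y` is nonnegative.
  have hjensen : a ^ 2 * ∫ z, gaussWeight (1 / 2) z ≤
      ∫ z, MvPolynomial.eval (y + t • z) p ^ 2 * gaussWeight (1 / 2) z := by
    have hnn : 0 ≤ ∫ z, (MvPolynomial.eval (y + t • z) p - a) ^ 2 * gaussWeight (1 / 2) z :=
      integral_nonneg fun z => mul_nonneg (sq_nonneg _) (gaussWeight_pos _ _).le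
    have heq : ∫ z, (MvPolynomial.eval (y + t • z) p - a) ^ 2 * gaussWeight (1 / 2) z =
        ∫ z, (MvPolynomial.eval (y + t • z) p ^ 2 * gaussWeight (1 / 2) z -
          2 * a * (MvPolynomial.eval (y + t • z) p * gaussWeight (1 / 2) z) +
          a ^ 2 * gaussWeight (1 / 2) z) := by
      congr 1 with z
      ring
    have hsub : Integrable fun z => MvPolynomial.eval (y + t • z) p ^ 2 * gaussWeight (1 / 2) z -
        2 * a * (MvPolynomial.eval (y + t • z) p * gaussWeight (1 / 2) z) :=
      h2.sub (h1.const_mul (2 * a))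
    rw [heq, integral_add hsub (hW.const_mul _), integral_sub h2 (h1.const_mul _),
      integral_const_mul, integral_const_mul, hmean] at hnn
    nlinarith
  -- Recentre the Gaussian at `x`; the wider weight absorbs the translation, `hw` being
  -- coordinatewise `-z² / 2 ≤ h² / 2 - (z + h)² / 4`.
  refine hjensen.trans ?_
  rw [← integral_const_mul, ← integral_add_right_eq_self
    (fun z => Real.exp (ρ ^ 2 / 2) * (MvPolynomial.eval (x + t • z) p ^ 2 * gaussWeight (1 / 4) z))
    h]
  refine integral_mono h2 ((h4.const_mul _).comp_add_right h) fun z => ?_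
  have hxz : x + t • (z + h) = y + t • z := by rw [hy, smul_add]; abel
  have hw : gaussWeight (1 / 2) z ≤ Real.exp (ρ ^ 2 / 2) * gaussWeight (1 / 4) (z + h) := by
    simp only [gaussWeight, ← Real.exp_sum, ← Real.exp_add]
    refine Real.exp_le_exp.mpr ?_
    simp only [Fin.sum_univ_three, Pi.add_apply] at hh ⊢
    nlinarith [sq_nonneg (z 0 - h 0), sq_nonneg (z 1 - h 1), sq_nonneg (z 2 - h 2)]
  simp only [hxz]
  calc MvPolynomial.eval (y + t • z) p ^ 2 * gaussWeight (1 / 2) z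
      ≤ MvPolynomial.eval (y + t • z) p ^ 2 *
        (Real.exp (ρ ^ 2 / 2) * gaussWeight (1 / 4) (z + h)) :=
        mul_le_mul_of_nonneg_left hw (sq_nonneg _)
    _ = _ := by ring

/-! ### Invariance of the surface measure and second moments of the coefficients -/

section Sphere

open scoped Pointwise

variable {E : Type*} [NormedAddCommGroup E] [InnerProductSpace ℝ E]

/-- The action of a linear isometry on the unit sphere. -/
def sphereMap (e : E ≃ₗᵢ[ℝ] E) (x : Metric.sphere (0 : E) 1) : Metric.sphere (0 : E) 1 :=
  ⟨e x, by simp⟩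

theorem continuous_sphereMap (e : E ≃ₗᵢ[ℝ] E) : Continuous (sphereMap e) :=
  (e.continuous.comp continuous_subtype_val).subtype_mk _

theorem injective_sphereMap (e : E ≃ₗᵢ[ℝ] E) : Function.Injective (sphereMap e) := fun _ _ h =>
  Subtype.ext (e.injective (congrArg Subtype.val h))

theorem exists_isometry_map_eq [FiniteDimensional ℝ E] {v w : E} (h : ‖v‖ = ‖w‖) :
    ∃ e : E ≃ₗᵢ[ℝ] E, e v = w :=
  ⟨_, Submodule.reflection_sub h⟩

variable [FiniteDimensional ℝ E] [MeasurableSpace E] [BorelSpace E]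

theorem measurePreserving_sphereMap (e : E ≃ₗᵢ[ℝ] E) :
    MeasurePreserving (sphereMap e) (volume : Measure E).toSphere
      (volume : Measure E).toSphere := by
  refine ⟨(continuous_sphereMap e).measurable, ?_⟩
  ext s hs
  have hs' := (continuous_sphereMap e).measurable hs
  rw [Measure.map_apply (continuous_sphereMap e).measurable hs, Measure.toSphere_apply' _ hs,
    Measure.toSphere_apply' _ hs']
  congr 1
  have hset : Set.Ioo (0 : ℝ) 1 • ((↑) '' (sphereMap e ⁻¹' s) : Set E) =
      e ⁻¹' (Set.Ioo (0 : ℝ) 1 • ((↑) '' s : Set E)) := by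
    ext y
    simp only [Set.mem_smul, Set.mem_image, Set.mem_preimage]
    constructor
    · rintro ⟨r, hr, _, ⟨x, hx, rfl⟩, rfl⟩
      exact ⟨r, hr, e x, ⟨_, hx, rfl⟩, by simp⟩
    · rintro ⟨r, hr, _, ⟨x, hx, rfl⟩, h⟩
      refine ⟨r, hr, e.symm x, ⟨sphereMap e.symm x, ?_, rfl⟩, e.injective (by simpa using h)⟩
      have : sphereMap e (sphereMap e.symm x) = x := Subtype.ext (by simp [sphereMap])
      simpa [this] using hx
  rw [hset]
  exact (LinearIsometryEquiv.measurePreserving e).measure_preimage_equiv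
    (f := e.toMeasurableEquiv) _

theorem integral_comp_sphereMap (e : E ≃ₗᵢ[ℝ] E) (f : Metric.sphere (0 : E) 1 → ℝ) :
    ∫ x, f (sphereMap e x) ∂(volume : Measure E).toSphere =
      ∫ x, f x ∂(volume : Measure E).toSphere :=
  (measurePreserving_sphereMap e).integral_comp
    ((continuous_sphereMap e).isClosedEmbedding (injective_sphereMap e)).measurableEmbedding f

/-- The second moment of the surface measure in a direction does not depend on the direction; by
polarization this determines all its second moments. -/
theorem integral_inner_sq_eq {v w : E} (h : ‖v‖ = ‖w‖) :
    ∫ x : Metric.sphere (0 : E) 1, inner ℝ v (x : E) ^ 2 ∂(volume : Measure E).toSphere =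
      ∫ x : Metric.sphere (0 : E) 1, inner ℝ w (x : E) ^ 2 ∂(volume : Measure E).toSphere := by
  obtain ⟨e, rfl⟩ := exists_isometry_map_eq h
  rw [← integral_comp_sphereMap e (fun x => inner ℝ (e v) (x : E) ^ 2)]
  simp [sphereMap]

end Sphere

/-- The random coefficients `c` have the second moments `E[cⱼ cₖ] = δⱼₖ / d`. This is the only
information on their law which matters for the estimate of the maximum. -/
structure IsIsotropic {Ω : Type*} [MeasurableSpace Ω] {d : ℕ} (μ : Measure Ω)
    (c : Ω → Fin d → ℝ) : Prop where
  integrable : ∀ j k, Integrable (fun ω => c ω j * c ω k) μ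
  integral_eq : ∀ j k, ∫ ω, c ω j * c ω k ∂μ = if j = k then 1 / (d : ℝ) else 0

theorem isIsotropic_gaussianCoeffLaw (d : ℕ) : IsIsotropic (gaussianCoeffLaw d) id := by
  set γ : Measure ℝ := gaussianReal 0 (1 / (d : NNReal)) with hγ
  have hmp : ∀ j : Fin d, MeasurePreserving (fun c : Fin d → ℝ => c j) (gaussianCoeffLaw d) γ :=
    fun j => measurePreserving_eval (fun _ : Fin d => γ) j
  have hL : ∀ j : Fin d, MemLp (fun c : Fin d → ℝ => c j) 2 (gaussianCoeffLaw d) := fun j =>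
    (memLp_id_gaussianReal' 2 (by simp)).comp_measurePreserving (hmp j)
  have h0 : ∀ j : Fin d, ∫ c, c j ∂(gaussianCoeffLaw d) = 0 := fun j => by
    have := integral_map (μ := gaussianCoeffLaw d) (hmp j).measurable.aemeasurable
      (f := fun x : ℝ => x) aestronglyMeasurable_id
    rw [← this, (hmp j).map_eq]
    exact integral_id_gaussianReal
  refine ⟨fun j k => (hL j).integrable_mul (hL k), fun j k => ?_⟩
  split_ifs with hjk
  · subst hjk
    have := integral_map (μ := gaussianCoeffLaw d) (hmp j).measurable.aemeasurable
      (f := fun x : ℝ => x * x) (by fun_prop)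
    simp only [id]
    rw [← this, (hmp j).map_eq]
    have hv := variance_of_integral_eq_zero (μ := γ) (X := id) aemeasurable_id
      (integral_id_gaussianReal)
    rw [variance_id_gaussianReal] at hv
    simpa [sq, hγ] using hv.symm
  · have hind : iIndepFun (fun (i : Fin d) (c : Fin d → ℝ) => c i) (gaussianCoeffLaw d) :=
      iIndepFun_pi (μ := fun _ : Fin d => γ) (X := fun _ x => x) fun _ => aemeasurable_id
    have := (hind.indepFun hjk).integral_fun_mul_eq_mul_integral
      (hL j).aestronglyMeasurable (hL k).aestronglyMeasurable
    simpa [h0] using this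

theorem isIsotropic_uniformSphereLaw (d : ℕ) :
    IsIsotropic (uniformSphereLaw d) (fun c j => c.1 j) := by
  set σ := (volume : Measure (EuclideanSpace ℝ (Fin d))).toSphere with hσ
  have hc : ∀ j k : Fin d, Continuous
      fun c : Metric.sphere (0 : EuclideanSpace ℝ (Fin d)) 1 => c.1 j * c.1 k := fun j k => by
    fun_prop
  have hi : ∀ j k : Fin d, Integrable
      (fun c : Metric.sphere (0 : EuclideanSpace ℝ (Fin d)) 1 => c.1 j * c.1 k) σ := fun j k =>
    (hc j k).integrable_of_hasCompactSupport (HasCompactSupport.of_compactSpace _)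
  -- In dimension zero there are no indices `j`, `k`; otherwise the total mass of `σ` is positive.
  have hpos : Fin d → σ Set.univ ≠ 0 := fun j => by
    have : Nonempty (Fin d) := ⟨j⟩
    rw [Ne, Measure.measure_univ_eq_zero]
    exact Measure.toSphere_ne_zero _
  have hsq : ∀ j k : Fin d, ∫ c, c.1 j * c.1 j ∂σ = ∫ c, c.1 k * c.1 k ∂σ := fun j k => by
    have := integral_inner_sq_eq (v := EuclideanSpace.single j (1 : ℝ))
      (w := EuclideanSpace.single k (1 : ℝ)) (by simp)
    simpa [EuclideanSpace.inner_single_left, sq] using this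
  have hdiag : ∀ j : Fin d, ∫ c, c.1 j * c.1 j ∂σ = σ.real Set.univ / d := fun j => by
    have h1 : ∫ c, ∑ k, c.1 k * c.1 k ∂σ = σ.real Set.univ := by
      have : ∀ c : Metric.sphere (0 : EuclideanSpace ℝ (Fin d)) 1, ∑ k, c.1 k * c.1 k = 1 :=
        fun c => by
          have h := EuclideanSpace.real_norm_sq_eq c.1
          rw [norm_eq_of_mem_sphere] at h
          simpa [sq] using h.symm
      simp [this]
    rw [integral_finsetSum _ fun k _ => hi k k, Finset.sum_congr rfl fun k _ => hsq k j] at h1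
    have hd : (d : ℝ) ≠ 0 := by
      have := j.pos
      positivity
    rw [← h1]
    simp
    field_simp
  have hoff : ∀ j k : Fin d, j ≠ k → ∫ c, c.1 j * c.1 k ∂σ = 0 := fun j k hjk => by
    have hn : ‖EuclideanSpace.single j (1 : ℝ) + EuclideanSpace.single k (1 : ℝ)‖ =
        ‖EuclideanSpace.single j (1 : ℝ) - EuclideanSpace.single k (1 : ℝ)‖ := by
      have hin : inner ℝ (EuclideanSpace.single k (1 : ℝ))
          (EuclideanSpace.single j (1 : ℝ)) = 0 := by
        simp [EuclideanSpace.inner_single_left, Ne.symm hjk]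
      exact (norm_sub_eq_norm_add hin).symm
    have h := integral_inner_sq_eq hn
    simp only [inner_add_left, inner_sub_left, EuclideanSpace.inner_single_left, map_one,
      one_mul] at h
    rw [← sub_eq_zero, ← integral_sub] at h
    · have h4 : ∫ c, 4 * (c.1 j * c.1 k) ∂σ = 0 := by
        rw [← h]
        congr 1 with c
        ring
      rw [integral_const_mul] at h4
      linarith
    · exact Continuous.integrable_of_hasCompactSupport (by fun_prop)
        (HasCompactSupport.of_compactSpace _)
    · exact Continuous.integrable_of_hasCompactSupport (by fun_prop)
        (HasCompactSupport.of_compactSpace _)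
  refine ⟨fun j k => (hi j k).smul_measure (ENNReal.inv_ne_top.mpr (hpos j)), fun j k => ?_⟩
  rw [uniformSphereLaw, integral_smul_measure]
  split_ifs with hjk
  · subst hjk
    have hr : σ.real Set.univ ≠ 0 := by
      rw [measureReal_def, Ne, ENNReal.toReal_eq_zero_iff]
      simp [hpos j, measure_ne_top]
    rw [← hσ, hdiag j, ENNReal.toReal_inv, ← measureReal_def, smul_eq_mul]
    field_simp
  · rw [← hσ, hoff j k hjk, smul_zero]

/-! ### Rotation invariance of spherical harmonics -/

/-- The chain rule for partial derivatives of a substitution of polynomials. -/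
theorem pderiv_bind₁ {σ τ : Type*} [Fintype σ] (f : σ → MvPolynomial τ ℝ) (i : τ)
    (p : MvPolynomial σ ℝ) :
    MvPolynomial.pderiv i (MvPolynomial.bind₁ f p) =
      ∑ j, MvPolynomial.bind₁ f (MvPolynomial.pderiv j p) * MvPolynomial.pderiv i (f j) := by
  classical
  induction p using MvPolynomial.induction_on with
  | C a => simp
  | add p q hp hq => simp only [map_add, hp, hq, add_mul, Finset.sum_add_distrib]
  | mul_X p k hp =>
    simp only [map_mul, MvPolynomial.bind₁_X_right, MvPolynomial.pderiv_mul, hp, map_add, add_mul,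
      Finset.sum_add_distrib, MvPolynomial.pderiv_X, Finset.sum_mul]
    congr 1
    · exact Finset.sum_congr rfl fun j _ => by ring
    · rw [Finset.sum_eq_single k]
      · simp
      · intro j _ hj
        simp [Ne.symm hj]
      · simp

/-- The matrix of a linear isometry of `ℝ³` in the standard basis. -/
def isometryMatrix (e : E3 ≃ₗᵢ[ℝ] E3) : Matrix (Fin 3) (Fin 3) ℝ :=
  Matrix.of fun i k => e (EuclideanSpace.single k 1) i

theorem isometry_apply_eq_sum (e : E3 ≃ₗᵢ[ℝ] E3) (x : E3) (i : Fin 3) :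
    e x i = ∑ k, isometryMatrix e i k * x k := by
  have hx : x = ∑ k, x k • EuclideanSpace.single k (1 : ℝ) := by
    ext i
    simp [Fin.sum_univ_three]
    fin_cases i <;> simp
  conv_lhs => rw [hx]
  simp [isometryMatrix, mul_comm]

theorem isometryMatrix_mul_transpose (e : E3 ≃ₗᵢ[ℝ] E3) :
    isometryMatrix e * (isometryMatrix e).transpose = 1 := by
  rw [mul_eq_one_comm]
  ext j k
  have h := e.inner_map_map (EuclideanSpace.single j (1 : ℝ)) (EuclideanSpace.single k (1 : ℝ))
  rw [PiLp.inner_apply] at h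
  simp only [EuclideanSpace.inner_single_left, map_one, one_mul] at h
  simp only [Matrix.mul_apply, Matrix.transpose_apply, isometryMatrix, Matrix.of_apply,
    Matrix.one_apply]
  convert h using 1
  · exact Finset.sum_congr rfl fun i _ => by simp [mul_comm]
  · simp

/-- The polynomial `p ∘ e`, for a linear isometry `e` of `ℝ³`. -/
def compIsometry (e : E3 ≃ₗᵢ[ℝ] E3) (p : MvPolynomial (Fin 3) ℝ) : MvPolynomial (Fin 3) ℝ :=
  MvPolynomial.bind₁
    (fun i => ∑ k, MvPolynomial.C (isometryMatrix e i k) * MvPolynomial.X k) p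

theorem eval_compIsometry (e : E3 ≃ₗᵢ[ℝ] E3) (p : MvPolynomial (Fin 3) ℝ) (x : E3) :
    MvPolynomial.eval (fun i => x i) (compIsometry e p) = MvPolynomial.eval (fun i => e x i) p := by
  rw [compIsometry, MvPolynomial.eval, MvPolynomial.eval₂Hom_bind₁]
  congr 2
  funext i
  rw [isometry_apply_eq_sum]
  simp

theorem isHomogeneous_compIsometry (e : E3 ≃ₗᵢ[ℝ] E3) {p : MvPolynomial (Fin 3) ℝ} {N : ℕ}
    (hp : p.IsHomogeneous N) : (compIsometry e p).IsHomogeneous N := by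
  have h := hp.aeval
    (fun i => ∑ k, MvPolynomial.C (isometryMatrix e i k) * MvPolynomial.X k) (n := 1) fun i =>
    MvPolynomial.IsHomogeneous.sum _ _ _ fun k _ => by
      simpa using (MvPolynomial.isHomogeneous_C (Fin 3) (isometryMatrix e i k)).mul
        (MvPolynomial.isHomogeneous_X ℝ k)
  rw [one_mul] at h
  exact h

/-- The Laplacian commutes with linear isometries. -/
theorem polyLaplacian_compIsometry (e : E3 ≃ₗᵢ[ℝ] E3) (p : MvPolynomial (Fin 3) ℝ) :
    polyLaplacian (compIsometry e p) = compIsometry e (polyLaplacian p) := by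
  set M := isometryMatrix e with hM
  set f : Fin 3 → MvPolynomial (Fin 3) ℝ :=
    fun i => ∑ k, MvPolynomial.C (M i k) * MvPolynomial.X k with hf
  have hdf : ∀ i j, MvPolynomial.pderiv i (f j) = MvPolynomial.C (M j i) := fun i j => by
    simp only [hf, map_sum, MvPolynomial.pderiv_C_mul, MvPolynomial.pderiv_X]
    rw [Finset.sum_eq_single i]
    · simp
    · intro k _ hk
      simp [hk]
    · simp
  have hrow : ∀ j k, ∑ i, M j i * M k i = if j = k then 1 else 0 := fun j k => by
    have h := congrFun (congrFun (isometryMatrix_mul_transpose e) j) k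
    simpa [Matrix.mul_apply, Matrix.one_apply] using h
  have h2 : ∀ i, MvPolynomial.pderiv i (MvPolynomial.pderiv i (MvPolynomial.bind₁ f p)) =
      ∑ j, ∑ k, MvPolynomial.bind₁ f (MvPolynomial.pderiv k (MvPolynomial.pderiv j p)) *
        MvPolynomial.C (M j i * M k i) := fun i => by
    simp only [pderiv_bind₁, hdf, map_sum, MvPolynomial.pderiv_mul, MvPolynomial.pderiv_C,
      mul_zero, add_zero, Finset.sum_mul, MvPolynomial.C_mul]
    exact Finset.sum_congr rfl fun j _ => Finset.sum_congr rfl fun k _ => by ring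
  change polyLaplacian (MvPolynomial.bind₁ f p) = MvPolynomial.bind₁ f (polyLaplacian p)
  rw [polyLaplacian_apply, polyLaplacian_apply, map_sum, Finset.sum_congr rfl fun i _ => h2 i,
    Finset.sum_comm]
  refine Finset.sum_congr rfl fun j _ => ?_
  rw [Finset.sum_comm]
  simp only [← Finset.mul_sum, ← map_sum, hrow]
  simp

theorem exists_poly_of_mem_sphHarm {N : ℕ} {g : C(S2, ℝ)} (hg : g ∈ sphHarm N) :
    ∃ p : MvPolynomial (Fin 3) ℝ, p.IsHomogeneous N ∧ polyLaplacian p = 0 ∧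
      ∀ x : S2, g x = MvPolynomial.eval (fun i => (x : E3) i) p := by
  obtain ⟨p, ⟨hp1, hp2⟩, rfl⟩ := hg
  exact ⟨p, hp1, hp2, fun _ => rfl⟩

theorem comp_sphereMap_mem_sphHarm {N : ℕ} {g : C(S2, ℝ)} (hg : g ∈ sphHarm N)
    (e : E3 ≃ₗᵢ[ℝ] E3) : g.comp ⟨sphereMap e, continuous_sphereMap e⟩ ∈ sphHarm N := by
  obtain ⟨p, hp, hharm, hgp⟩ := exists_poly_of_mem_sphHarm hg
  refine ⟨compIsometry e p, ⟨isHomogeneous_compIsometry e hp, ?_⟩, ?_⟩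
  · change polyLaplacian _ = 0
    rw [polyLaplacian_compIsometry, hharm]
    simp [compIsometry]
  · ext x
    exact (eval_compIsometry e p x).trans (hgp (sphereMap e x)).symm

/-! ### The reproducing kernel on the diagonal -/

instance : IsFiniteMeasure surfaceMeasure := by unfold surfaceMeasure; infer_instance

theorem integrable_surfaceMeasure (g : C(S2, ℝ)) : Integrable g surfaceMeasure :=
  g.continuous.integrable_of_hasCompactSupport (HasCompactSupport.of_compactSpace _)

/-- The diagonal of the reproducing kernel of `H_N` is rotation invariant: composing an orthonormal
basis with a linear isometry gives another one, related to it by an orthogonal matrix. -/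
theorem sum_sq_comp_sphereMap {N : ℕ} {φ : Fin (sphDim N) → C(S2, ℝ)}
    (hφ : IsOrthonormalBasis N φ) (e : E3 ≃ₗᵢ[ℝ] E3) (x : S2) :
    ∑ j, φ j (sphereMap e x) ^ 2 = ∑ j, φ j x ^ 2 := by
  have hmem : ∀ j, ∃ a : Fin (sphDim N) → ℝ,
      ∑ k, a k • φ k = (φ j).comp ⟨sphereMap e, continuous_sphereMap e⟩ := fun j => by
    rw [← Submodule.mem_span_range_iff_exists_fun, hφ.span_eq]
    refine comp_sphereMap_mem_sphHarm ?_ e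
    rw [← hφ.span_eq]
    exact Submodule.subset_span ⟨j, rfl⟩
  choose a ha using hmem
  have hval : ∀ j y, φ j (sphereMap e y) = ∑ k, a j k * φ k y := fun j y => by
    have h := DFunLike.congr_fun (ha j) y
    simpa using h.symm
  have hortho : Matrix.of a * (Matrix.of a).transpose = 1 := by
    ext j l
    have h1 : ∫ y, φ j (sphereMap e y) * φ l (sphereMap e y) ∂surfaceMeasure =
        if j = l then 1 else 0 := by
      rw [← hφ.orthonormal j l]
      exact integral_comp_sphereMap e fun y => φ j y * φ l y
    have h2 : ∀ k m, Integrable (fun y => a j k * φ k y * (a l m * φ m y)) surfaceMeasure :=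
      fun k m => integrable_surfaceMeasure ((a j k • φ k) * (a l m • φ m))
    have h3 : ∀ k m, ∫ y, a j k * φ k y * (a l m * φ m y) ∂surfaceMeasure =
        a j k * a l m * if k = m then 1 else 0 := fun k m => by
      rw [← hφ.orthonormal k m, ← integral_const_mul]
      congr 1 with y
      ring
    simp only [hval, Finset.sum_mul_sum] at h1
    rw [integral_finsetSum _ fun k _ => integrable_finsetSum _ fun m _ => h2 k m,
      Finset.sum_congr rfl fun k _ => integral_finsetSum _ fun m _ => h2 k m] at h1
    simp only [h3] at h1
    simpa [Matrix.mul_apply, Matrix.one_apply] using h1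
  have hortho' := mul_eq_one_comm.mp hortho
  have hcol : ∀ k m, ∑ j, a j k * a j m = if k = m then 1 else 0 := fun k m => by
    have h := congrFun (congrFun hortho' k) m
    simpa [Matrix.mul_apply, Matrix.one_apply] using h
  calc ∑ j, φ j (sphereMap e x) ^ 2
      = ∑ j, ∑ k, ∑ m, a j k * φ k x * (a j m * φ m x) := by
        simp only [hval, sq, Finset.sum_mul_sum]
    _ = ∑ k, ∑ m, ∑ j, a j k * φ k x * (a j m * φ m x) := by
        rw [Finset.sum_comm]
        exact Finset.sum_congr rfl fun k _ => Finset.sum_comm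
    _ = ∑ k, ∑ m, (∑ j, a j k * a j m) * (φ k x * φ m x) := by
        simp only [Finset.sum_mul]
        exact Finset.sum_congr rfl fun k _ => Finset.sum_congr rfl fun m _ =>
          Finset.sum_congr rfl fun j _ => by ring
    _ = ∑ j, φ j x ^ 2 := by
        simp [hcol, sq]

theorem surfaceMeasure_real_univ_pos : 0 < surfaceMeasure.real Set.univ := by
  refine ENNReal.toReal_pos ?_ (measure_ne_top _ _)
  rw [Ne, Measure.measure_univ_eq_zero]
  exact Measure.toSphere_ne_zero _

theorem sum_sq_eq_div {N : ℕ} {φ : Fin (sphDim N) → C(S2, ℝ)}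
    (hφ : IsOrthonormalBasis N φ) (x : S2) :
    ∑ j, φ j x ^ 2 = sphDim N / surfaceMeasure.real Set.univ := by
  have hconst : ∀ y : S2, ∑ j, φ j y ^ 2 = ∑ j, φ j x ^ 2 := fun y => by
    obtain ⟨e, he⟩ := exists_isometry_map_eq (v := (x : E3)) (w := (y : E3)) (by simp)
    have hy : y = sphereMap e x := Subtype.ext he.symm
    rw [hy, sum_sq_comp_sphereMap hφ]
  have h1 : ∫ y, ∑ j, φ j y ^ 2 ∂surfaceMeasure = sphDim N := by
    have hi : ∀ j, Integrable (fun y => φ j y ^ 2) surfaceMeasure := fun j =>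
      integrable_surfaceMeasure (φ j ^ 2)
    rw [integral_finsetSum _ fun j _ => hi j]
    simp [sq, hφ.orthonormal]
  simp only [hconst, integral_const, smul_eq_mul] at h1
  rw [eq_div_iff surfaceMeasure_real_univ_pos.ne', mul_comm, h1]

theorem eval_mul_of_isHomogeneous {σ : Type*} [Fintype σ] {p : MvPolynomial σ ℝ} {N : ℕ}
    (hp : p.IsHomogeneous N) (r : ℝ) (x : σ → ℝ) :
    MvPolynomial.eval (fun i => r * x i) p = r ^ N * MvPolynomial.eval x p := by
  rw [MvPolynomial.eval_eq', MvPolynomial.eval_eq', Finset.mul_sum]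
  refine Finset.sum_congr rfl fun d hd => ?_
  have hN : ∑ i, d i = N := by
    have h := hp (MvPolynomial.mem_support_iff.mp hd)
    rwa [Finsupp.weight_apply, Finsupp.sum_fintype _ _ (by simp), Finset.sum_congr rfl fun i _ =>
      by rw [Pi.one_apply, smul_eq_mul, mul_one]] at h
  simp only [mul_pow, Finset.prod_mul_distrib, Finset.prod_pow_eq_pow_sum, hN]
  ring

/-- The homogeneous extension to `ℝ³` of the diagonal of the reproducing kernel. -/
theorem sum_sq_eval_eq {N : ℕ} {φ : Fin (sphDim N) → C(S2, ℝ)} (hφ : IsOrthonormalBasis N φ)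
    {P : Fin (sphDim N) → MvPolynomial (Fin 3) ℝ} (hP : ∀ j, (P j).IsHomogeneous N)
    (hPφ : ∀ j (x : S2), φ j x = MvPolynomial.eval (fun i => (x : E3) i) (P j)) (y : E3) :
    ∑ j, MvPolynomial.eval (fun i => y i) (P j) ^ 2 =
      ‖y‖ ^ (2 * N) * (sphDim N / surfaceMeasure.real Set.univ) := by
  obtain ⟨u, hu⟩ : ∃ u : S2, y = ‖y‖ • (u : E3) := by
    by_cases hy : y = 0
    · exact ⟨⟨EuclideanSpace.single 0 1, by simp⟩, by simp [hy]⟩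
    · refine ⟨⟨‖y‖⁻¹ • y, ?_⟩, ?_⟩
      · simp [norm_smul, hy]
      · simp [smul_smul, hy]
  have heval : ∀ j, MvPolynomial.eval (fun i => y i) (P j) = ‖y‖ ^ N * φ j u := fun j => by
    have hy : (fun i => y i) = fun i => ‖y‖ * (u : E3) i := by
      funext i
      conv_lhs => rw [hu]
      simp
    rw [hy, hPφ, eval_mul_of_isHomogeneous (hP j)]
  simp only [heval, mul_pow, ← Finset.mul_sum, sum_sq_eq_div hφ u]
  ring

/-! ### The second moment bound -/

/-- The weight which controls the growth of the kernel of `H_N` at distance `|z| / N` from the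
sphere, uniformly in `N`. -/
def growthWeight (z : Fin 3 → ℝ) : ℝ :=
  ∏ i, (Real.exp (2 * |z i|) * Real.exp (-(1 / 4) * z i ^ 2))

theorem growthWeight_nonneg (z : Fin 3 → ℝ) : 0 ≤ growthWeight z :=
  Finset.prod_nonneg fun _ _ => by positivity

theorem integrable_growthWeight : Integrable growthWeight := by
  refine Integrable.fintype_prod (μ := fun _ : Fin 3 => (volume : Measure ℝ))
    (f := fun _ z => Real.exp (2 * |z|) * Real.exp (-(1 / 4) * z ^ 2)) fun _ => ?_
  refine ((integrable_exp_neg_mul_sq (b := 1 / 8) (by norm_num)).const_mul (Real.exp 8)).mono'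
    (by fun_prop) (Filter.Eventually.of_forall fun z => ?_)
  rw [Real.norm_of_nonneg (by positivity), ← Real.exp_add, ← Real.exp_add]
  refine Real.exp_le_exp.mpr ?_
  have := sq_abs z
  nlinarith [sq_nonneg (|z| - 8)]

theorem norm_toLp_le_sum_abs (z : Fin 3 → ℝ) : ‖(WithLp.toLp 2 z : E3)‖ ≤ ∑ i, |z i| := by
  refine abs_le_of_sq_le_sq' ?_ (Finset.sum_nonneg fun i _ => abs_nonneg _) |>.2
  rw [EuclideanSpace.real_norm_sq_eq]
  simp only [Fin.sum_univ_three, ← sq_abs (z _)]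
  have h0 := abs_nonneg (z 0)
  have h1 := abs_nonneg (z 1)
  have h2 := abs_nonneg (z 2)
  nlinarith [mul_nonneg h0 h1, mul_nonneg h0 h2, mul_nonneg h1 h2]

theorem norm_pow_mul_gaussWeight_le (x : S2) {N : ℕ} (hN : 1 ≤ N) (z : Fin 3 → ℝ) :
    ‖(x : E3) + (1 / N : ℝ) • (WithLp.toLp 2 z : E3)‖ ^ (2 * N) * gaussWeight (1 / 4) z ≤
      growthWeight z := by
  have hN' : (0 : ℝ) < N := by exact_mod_cast hN
  have h1 : ‖(x : E3) + (1 / N : ℝ) • (WithLp.toLp 2 z : E3)‖ ≤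
      Real.exp ((1 / N : ℝ) * ∑ i, |z i|) := by
    calc _ ≤ ‖(x : E3)‖ + ‖(1 / N : ℝ) • (WithLp.toLp 2 z : E3)‖ := norm_add_le _ _
      _ ≤ 1 + (1 / N : ℝ) * ∑ i, |z i| := by
        rw [norm_eq_of_mem_sphere, norm_smul, Real.norm_of_nonneg (by positivity)]
        gcongr
        exact norm_toLp_le_sum_abs z
      _ ≤ _ := by
        rw [add_comm]
        exact Real.add_one_le_exp _
  rw [growthWeight, Finset.prod_mul_distrib, gaussWeight]
  refine mul_le_mul_of_nonneg_right ?_ (Finset.prod_nonneg fun _ _ => (Real.exp_pos _).le)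
  refine (pow_le_pow_left₀ (norm_nonneg _) h1 _).trans (le_of_eq ?_)
  rw [← Real.exp_nat_mul, ← Real.exp_sum, ← Finset.mul_sum]
  congr 1
  push_cast
  field_simp

theorem norm_sub_le_angle (x y : S2) :
    ‖(y : E3) - x‖ ≤ InnerProductGeometry.angle (x : E3) (y : E3) := by
  refine abs_le_of_sq_le_sq' ?_ (InnerProductGeometry.angle_nonneg _ _) |>.2
  have h := InnerProductGeometry.cos_angle_mul_norm_mul_norm (x : E3) (y : E3)
  rw [norm_sub_sq_real, real_inner_comm, ← h, norm_eq_of_mem_sphere, norm_eq_of_mem_sphere]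
  have := Real.one_sub_sq_div_two_le_cos (x := InnerProductGeometry.angle (x : E3) (y : E3))
  linarith

/-- The local Gaussian average of `f²` which controls the maximum of `f²`, written as a quadratic
form in the coefficients of `f`. -/
def localEnergy {d : ℕ} (P : Fin d → MvPolynomial (Fin 3) ℝ) (x : S2) (t : ℝ) (c : Fin d → ℝ) :
    ℝ :=
  ∫ z, MvPolynomial.eval ((fun i => (x : E3) i) + t • z) (∑ j, c j • P j) ^ 2 *
    gaussWeight (1 / 4) z

theorem localEnergy_nonneg {d : ℕ} (P : Fin d → MvPolynomial (Fin 3) ℝ) (x : S2) (t : ℝ)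
    (c : Fin d → ℝ) : 0 ≤ localEnergy P x t c :=
  integral_nonneg fun z => mul_nonneg (sq_nonneg _) (gaussWeight_pos _ z).le

theorem localEnergy_eq_sum {d : ℕ} (P : Fin d → MvPolynomial (Fin 3) ℝ) (x : S2) (t : ℝ)
    (c : Fin d → ℝ) :
    localEnergy P x t c = ∑ j, ∑ k, c j * c k *
      ∫ z, MvPolynomial.eval ((fun i => (x : E3) i) + t • z) (P j * P k) *
        gaussWeight (1 / 4) z := by
  have hi : ∀ j k, Integrable fun z => c j * c k *
      (MvPolynomial.eval ((fun i => (x : E3) i) + t • z) (P j * P k) * gaussWeight (1 / 4) z) :=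
    fun j k => (integrable_eval_mul_gaussWeight (by norm_num) _ t (P j * P k)).const_mul _
  simp only [← integral_const_mul]
  rw [← Finset.sum_congr rfl fun j _ => integral_finsetSum _ fun k _ => hi j k,
    ← integral_finsetSum _ fun j _ => integrable_finsetSum _ fun k _ => hi j k, localEnergy]
  congr 1 with z
  simp only [map_sum, MvPolynomial.smul_eval, sq, Finset.sum_mul_sum, map_mul]
  rw [Finset.sum_mul]
  refine Finset.sum_congr rfl fun j _ => ?_
  rw [Finset.sum_mul]
  exact Finset.sum_congr rfl fun k _ => by ring

theorem integrable_localEnergy {Ω : Type*} [MeasurableSpace Ω] {d : ℕ} {μ : Measure Ω}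
    {c : Ω → Fin d → ℝ} (hc : IsIsotropic μ c) (P : Fin d → MvPolynomial (Fin 3) ℝ) (x : S2)
    (t : ℝ) : Integrable (fun ω => localEnergy P x t (c ω)) μ := by
  simp only [localEnergy_eq_sum]
  exact integrable_finsetSum _ fun j _ => integrable_finsetSum _ fun k _ =>
    (hc.integrable j k).mul_const _

/-- At scale `1 / N` the expected local energy is bounded uniformly in `N`: it is a Gaussian average
of the kernel of `H_N`, which is `|y|^(2N)` up to a constant. -/
theorem integral_localEnergy_le {Ω : Type*} [MeasurableSpace Ω] {N : ℕ} (hN : 1 ≤ N)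
    {μ : Measure Ω} {c : Ω → Fin (sphDim N) → ℝ} (hc : IsIsotropic μ c)
    {φ : Fin (sphDim N) → C(S2, ℝ)} (hφ : IsOrthonormalBasis N φ)
    {P : Fin (sphDim N) → MvPolynomial (Fin 3) ℝ} (hP : ∀ j, (P j).IsHomogeneous N)
    (hPφ : ∀ j (x : S2), φ j x = MvPolynomial.eval (fun i => (x : E3) i) (P j)) (x : S2) :
    ∫ ω, localEnergy P x (1 / N) (c ω) ∂μ ≤
      (∫ z, growthWeight z) / surfaceMeasure.real Set.univ := by
  have hm := surfaceMeasure_real_univ_pos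
  set m := surfaceMeasure.real Set.univ with hm_def
  set y : (Fin 3 → ℝ) → Fin 3 → ℝ := fun z => (fun i => (x : E3) i) + (1 / N : ℝ) • z with hy
  have hi : ∀ j, Integrable fun z =>
      MvPolynomial.eval (y z) (P j * P j) * gaussWeight (1 / 4) z := fun j =>
    integrable_eval_mul_gaussWeight (by norm_num) _ _ _
  have h1 : ∫ ω, localEnergy P x (1 / N) (c ω) ∂μ = ∫ z, 1 / (sphDim N : ℝ) *
      ∑ j, MvPolynomial.eval (y z) (P j * P j) * gaussWeight (1 / 4) z := by
    simp only [localEnergy_eq_sum]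
    rw [integral_finsetSum _ fun j _ => integrable_finsetSum _ fun k _ =>
        (hc.integrable j k).mul_const _,
      Finset.sum_congr rfl fun j _ => integral_finsetSum _ fun k _ =>
        (hc.integrable j k).mul_const _]
    simp only [integral_mul_const, hc.integral_eq]
    rw [integral_const_mul, integral_finsetSum _ fun j _ => hi j, Finset.mul_sum]
    simp [hy]
  rw [h1, ← integral_div]
  refine integral_mono ((integrable_finsetSum _ fun j _ => hi j).const_mul _)
    (integrable_growthWeight.div_const m) fun z => ?_
  have hker := sum_sq_eval_eq hφ hP hPφ ((x : E3) + (1 / N : ℝ) • (WithLp.toLp 2 z : E3))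
  have hyz : (fun i => ((x : E3) + (1 / N : ℝ) • (WithLp.toLp 2 z : E3)) i) = y z := by
    funext i
    simp [hy]
  rw [hyz] at hker
  have hg := norm_pow_mul_gaussWeight_le x hN z
  set r := ‖(x : E3) + (1 / N : ℝ) • (WithLp.toLp 2 z : E3)‖ ^ (2 * N) with hr
  simp only [← sq, ← Finset.sum_mul, map_pow, hker]
  -- The factor is `1` unless the dimension vanishes.
  have hd : 1 / (sphDim N : ℝ) * sphDim N ≤ 1 := by
    rw [one_div_mul_eq_div]
    exact div_self_le_one _
  have hnn : 0 ≤ r * gaussWeight (1 / 4) z / m :=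
    div_nonneg (mul_nonneg (by positivity) (gaussWeight_pos _ z).le) hm.le
  calc 1 / (sphDim N : ℝ) * (r * (sphDim N / m) * gaussWeight (1 / 4) z)
      = (1 / (sphDim N : ℝ) * sphDim N) * (r * gaussWeight (1 / 4) z / m) := by ring
    _ ≤ 1 * (r * gaussWeight (1 / 4) z / m) := mul_le_mul_of_nonneg_right hd hnn
    _ ≤ growthWeight z / m := by
        rw [one_mul]
        exact div_le_div_of_nonneg_right hg hm.le

theorem integral_gaussWeight_pos : 0 < ∫ z, gaussWeight (1 / 2) z := by
  have hi : Integrable (gaussWeight (1 / 2)) := by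
    simpa using integrable_eval_mul_gaussWeight (b := 1 / 2) (by norm_num) 0 0 1
  rw [integral_pos_iff_support_of_nonneg (fun z => (gaussWeight_pos _ z).le) hi]
  have : Function.support (gaussWeight (1 / 2)) = Set.univ :=
    Set.eq_univ_of_forall fun z => (gaussWeight_pos _ z).ne'
  rw [this]
  simp

/-- The maximum of `f²` over a ball of radius `ρ / N` is controlled by the local energy of `f` at
scale `1 / N`. -/
theorem sq_maxOnBall_le {ρ : ℝ} (hρ : 0 < ρ) {N : ℕ} (hN : 1 ≤ N) {d : ℕ}
    {φ : Fin d → C(S2, ℝ)} {P : Fin d → MvPolynomial (Fin 3) ℝ}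
    (hP : ∀ j, polyLaplacian (P j) = 0)
    (hPφ : ∀ j (x : S2), φ j x = MvPolynomial.eval (fun i => (x : E3) i) (P j)) (x₀ : S2)
    (c : Fin d → ℝ) :
    maxOnBall (combination φ c) x₀ (ρ / N) ^ 2 * ∫ z, gaussWeight (1 / 2) z ≤
      Real.exp (ρ ^ 2 / 2) * localEnergy P x₀ (1 / N) c := by
  have hN' : (0 : ℝ) < N := by exact_mod_cast hN
  obtain ⟨x, hx, hmax⟩ := (isGreatest_maxOnBall (combination φ c) x₀
    (div_pos hρ hN').le).1
  have hdist : ‖(x : E3) - x₀‖ ≤ ρ / N := (norm_sub_le_angle x₀ x).trans hx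
  set h : Fin 3 → ℝ := fun i => N * ((x : E3) i - (x₀ : E3) i) with hh
  have hsum : ∑ i, h i ^ 2 ≤ ρ ^ 2 := by
    have h1 : ∑ i, h i ^ 2 = (N * ‖(x : E3) - x₀‖) ^ 2 := by
      rw [mul_pow, EuclideanSpace.real_norm_sq_eq, Finset.mul_sum]
      simp [hh, mul_pow]
    rw [h1]
    refine pow_le_pow_left₀ (by positivity) ?_ 2
    calc (N : ℝ) * ‖(x : E3) - x₀‖ ≤ N * (ρ / N) := by gcongr
      _ = ρ := by field_simp
  have hxh : (fun i => (x₀ : E3) i) + (1 / N : ℝ) • h = fun i => (x : E3) i := by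
    funext i
    simp only [hh, Pi.add_apply, Pi.smul_apply, smul_eq_mul]
    field_simp
    ring
  have hharm : polyLaplacian (∑ j, c j • P j) = 0 := by simp [hP]
  have key := sq_eval_le_of_harmonic (fun i => (x₀ : E3) i) h (1 / N) hharm hsum
  have hval : MvPolynomial.eval (fun i => (x : E3) i) (∑ j, c j • P j) = combination φ c x := by
    simp [combination, hPφ]
  rw [hxh, hval] at key
  rw [← hmax, localEnergy]
  simpa only [sq_abs] using key

/-- The estimate of the maximum, for any random coefficients with isotropic second moments. -/
theorem measure_maxOnBall_le {ρ : ℝ} (hρ : 0 < ρ) : ∃ A : ℝ, ∀ N : ℕ, 1 ≤ N →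
    ∀ φ : Fin (sphDim N) → C(S2, ℝ), IsOrthonormalBasis N φ → ∀ x₀ : S2,
    ∀ {Ω : Type} [MeasurableSpace Ω] (μ : Measure Ω) (c : Ω → Fin (sphDim N) → ℝ),
      IsIsotropic μ c → μ {ω | A ≤ maxOnBall (combination φ (c ω)) x₀ (ρ / N)} ≤ 1 / 3 := by
  have hW := integral_gaussWeight_pos
  set W := ∫ z, gaussWeight (1 / 2) z with hW_def
  set B := (∫ z, growthWeight z) / surfaceMeasure.real Set.univ with hB_def
  have hB : 0 ≤ B :=
    div_nonneg (integral_nonneg growthWeight_nonneg) surfaceMeasure_real_univ_pos.le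
  have hE := Real.exp_pos (ρ ^ 2 / 2)
  set E := Real.exp (ρ ^ 2 / 2) with hE_def
  -- `B` bounds the expected local energy and `E / W` the ratio of the squared maximum to it;
  -- `B + 1` keeps the threshold in Markov's inequality positive.
  refine ⟨Real.sqrt (3 * (B + 1) * E / W), fun N hN φ hφ x₀ Ω _ μ c hc => ?_⟩
  have hpoly : ∀ j, ∃ p : MvPolynomial (Fin 3) ℝ, p.IsHomogeneous N ∧ polyLaplacian p = 0 ∧
      ∀ x : S2, φ j x = MvPolynomial.eval (fun i => (x : E3) i) p := fun j =>
    exists_poly_of_mem_sphHarm (by rw [← hφ.span_eq]; exact Submodule.subset_span ⟨j, rfl⟩)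
  choose P hP hharm hPφ using hpoly
  have hint := integrable_localEnergy hc P x₀ (1 / N)
  have hsub : {ω | Real.sqrt (3 * (B + 1) * E / W) ≤
        maxOnBall (combination φ (c ω)) x₀ (ρ / N)} ⊆
      {ω | ENNReal.ofReal (3 * (B + 1)) ≤ ENNReal.ofReal (localEnergy P x₀ (1 / N) (c ω))} := by
    intro ω hω
    refine ENNReal.ofReal_le_ofReal ?_
    have h1 := pow_le_pow_left₀ (Real.sqrt_nonneg _) hω 2
    rw [Real.sq_sqrt (by positivity), div_le_iff₀ hW] at h1
    have h2 := h1.trans (sq_maxOnBall_le hρ hN hharm hPφ x₀ (c ω))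
    rw [mul_comm] at h2
    exact le_of_mul_le_mul_left h2 hE
  calc μ _ ≤ _ := measure_mono hsub
    _ ≤ (∫⁻ ω, ENNReal.ofReal (localEnergy P x₀ (1 / N) (c ω)) ∂μ) /
          ENNReal.ofReal (3 * (B + 1)) :=
        meas_ge_le_lintegral_div hint.aemeasurable.ennreal_ofReal
          (by simp; positivity) ENNReal.ofReal_ne_top
    _ = ENNReal.ofReal ((∫ ω, localEnergy P x₀ (1 / N) (c ω) ∂μ) / (3 * (B + 1))) := by
        rw [← ofReal_integral_eq_lintegral_ofReal hint
          (Filter.Eventually.of_forall fun ω => localEnergy_nonneg _ _ _ _),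
          ENNReal.ofReal_div_of_pos (by positivity)]
    _ ≤ ENNReal.ofReal (1 / 3) := by
        refine ENNReal.ofReal_le_ofReal ?_
        rw [div_le_iff₀ (by positivity)]
        have := integral_localEnergy_le hN hc hφ hP hPφ x₀
        linarith
    _ = 1 / 3 := by
        rw [ENNReal.ofReal_div_of_pos (by norm_num)]
        simp

end RandomSphericalHarmonics
end

open RandomSphericalHarmonics
theorem mainTheorem2 (ρ : ℝ) (hρ : 0 < ρ) :
    ∃ A : ℝ, ∀ N : ℕ, 1 ≤ N →
      ∀ φ : Fin (sphDim N) → C(S2, ℝ), IsOrthonormalBasis N φ →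
      ∀ x₀ : S2,
        gaussianCoeffLaw (sphDim N)
            {c | A ≤ maxOnBall (combination φ c) x₀ (ρ / N)} ≤ 1 / 3 ∧
        uniformSphereLaw (sphDim N)
            {c | A ≤ maxOnBall (combination φ (fun j => c.1 j)) x₀ (ρ / N)} ≤ 1 / 3 := by
  obtain ⟨A, hA⟩ := measure_maxOnBall_le hρ
  exact ⟨A, fun N hN φ hφ x₀ => ⟨hA N hN φ hφ x₀ _ _ (isIsotropic_gaussianCoeffLaw _),
    hA N hN φ hφ x₀ _ _ (isIsotropic_uniformSphereLaw _)⟩⟩
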